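/- Let $p$ be a prime and let $G$ be a finite nilpotent group of order $p^n r$ with $\gcd(p,r)=1$. Let $\mathbb{F}$ be any field of characteristic $p$, and let $M_G\colon G\times G\times G\to\mathbb{F}$ be the multiplication tensor of $G$, i.e. $M_G(g,h,k)=1$ if $gh=k$ and $M_G(g,h,k)=0$ otherwise (the structure constants of the group algebra $\mathbb{F}[G]$ in the basis of group elements). Then the slice rank of $M_G$ over $\mathbb{F}$ is at least \[ \frac{3\,p^n r}{2^{\,n+2}}. \] Here the slice rank of a function $T\colon X\times Y\times Z\to\mathbb{F}$ on finite sets is the smallest $s\ge 0$ for which there are integers $0\le a\le b\le s$ and $\mathbb{F}$-valued functions $f_i,g_i$ with \[ T(x,y,z)=\sum_{i=1}^{a} f_i(x,y)\,g_i(z)+\sum_{i=a+1}^{b} f_i(x,z)\,g_i(y)+\sum_{i=b+1}^{s} f_i(y,z)\,g_i(x) \] for all $x\in X$, $y\in Y$, $z\in Z$. -/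

import Mathlib

/-- `HasSliceDecomp T r`: the 3-tensor `T : X × Y × Z → 𝕜` is a sum of exactly `r` slices, that is
`T(x,y,z) = ∑ f₁ᵢ(x,y) g₁ᵢ(z) + ∑ f₂ᵢ(x,z) g₂ᵢ(y) + ∑ f₃ᵢ(y,z) g₃ᵢ(x)`,
the three sums having `a`, `b`, `c` terms with `a + b + c = r`. -/
def HasSliceDecomp {X Y Z 𝕜 : Type*} [Field 𝕜] (T : X → Y → Z → 𝕜) (r : ℕ) : Prop :=
  ∃ a b c : ℕ, a + b + c = r ∧
    ∃ (f₁ : Fin a → X → Y → 𝕜) (g₁ : Fin a → Z → 𝕜)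
      (f₂ : Fin b → X → Z → 𝕜) (g₂ : Fin b → Y → 𝕜)
      (f₃ : Fin c → Y → Z → 𝕜) (g₃ : Fin c → X → 𝕜),
      ∀ x y z, T x y z =
        ∑ i, f₁ i x y * g₁ i z + ∑ i, f₂ i x z * g₂ i y + ∑ i, f₃ i y z * g₃ i x

/-- The slice rank of a 3-tensor: the smallest number of slices that add up to it. -/
noncomputable def sliceRank {X Y Z 𝕜 : Type*} [Field 𝕜] (T : X → Y → Z → 𝕜) : ℕ :=
  sInf {r | HasSliceDecomp T r}

/-- On finite index sets a slice decomposition exists, so that the minimum is over a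
nonempty set. -/
theorem exists_hasSliceDecomp {X Y Z 𝕜 : Type*} [Finite X] [Field 𝕜] (T : X → Y → Z → 𝕜) :
    ∃ r, HasSliceDecomp T r := by
  classical
  obtain ⟨m, ⟨e⟩⟩ := Finite.exists_equiv_fin X
  refine ⟨0 + 0 + m, 0, 0, m, rfl, fun _ _ _ => 0, fun _ _ => 0, fun _ _ _ => 0, fun _ _ => 0,
    fun i y z => T (e.symm i) y z, fun i x => if e x = i then 1 else 0, fun x y z => ?_⟩
  simp

/-- The minimum in the definition of the slice rank is attained. -/
theorem hasSliceDecomp_sliceRank {X Y Z 𝕜 : Type*} [Finite X] [Field 𝕜] (T : X → Y → Z → 𝕜) :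
    HasSliceDecomp T (sliceRank T) :=
  Nat.sInf_mem (exists_hasSliceDecomp T)

/-- The multiplication tensor of an algebra `D` relative to a basis `x`: its structure constants
`T(i,j,k)`, given by `xᵢ xⱼ = ∑ₖ T(i,j,k) xₖ`. -/
noncomputable def multTensor {ι 𝕜 D : Type*} [Field 𝕜] [Ring D] [Algebra 𝕜 D]
    (x : Module.Basis ι 𝕜 D) : ι → ι → ι → 𝕜 :=
  fun i j k => x.repr (x i * x j) k

/-- The `G`-multiplication tensor over the field `𝕜`: the multiplication tensor of the group
algebra `𝕜[G]` relative to the basis of group elements. -/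
noncomputable def groupMultTensor (𝕜 G : Type*) [Field 𝕜] [Group G] : G → G → G → 𝕜 :=
  multTensor (MonoidAlgebra.basis G 𝕜)

open Classical in
/-- The `G`-multiplication tensor is the indicator function of the relation `g * h = k`. -/
theorem groupMultTensor_apply (𝕜 G : Type*) [Field 𝕜] [Group G] (g h k : G) :
    groupMultTensor 𝕜 G g h k = if g * h = k then 1 else 0 := by
  simp [groupMultTensor, multTensor, MonoidAlgebra.basis, Finsupp.single_apply]

/-! A tensor with nonzero weight-zero diagonal and all other entries in negative weight has full
slice rank (`HasSliceDecomp.card_le_of_weights`), so it suffices to build a large diagonal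
degeneration of the group algebra, over the algebraic closure since slice decompositions survive
field extension. If `p` does not divide the order, the algebra is a product of matrix algebras by
Maschke and Wedderburn, and Strassen's degeneration gives 3/4 of the dimension. Otherwise take a
central `z` of order `p`. The element `z - 1` is central with `p`-th power zero, and multiplication
by its power `p - 1` factors through the algebra of `G ⧸ ⟨z⟩`. Using powers of `z - 1` up to about
`p / 2` lifts a degeneration of the quotient (`HasDiagonalDegeneration.of_central_nilpotent`) and
multiplies its size by at least `p / 2`. After `n` such steps the size is at least `(3/4) r
(p/2)^n`. -/

/-- An algebra has a diagonal degeneration of size `N` if, with respect to suitable families of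
vectors and functionals of size `N` and suitable integral weights, its multiplication tensor is
supported in negative weight apart from a nonzero diagonal of weight zero. -/
def HasDiagonalDegeneration (K A : Type*) [Field K] [Ring A] [Algebra K A] (N : ℕ) : Prop :=
  ∃ (ι : Type) (_ : Fintype ι) (a b : ι → A) (c : ι → A →ₗ[K] K) (u v w : ι → ℤ),
    Fintype.card ι = N ∧ (∀ i, u i + v i + w i = 0) ∧ (∀ i, c i (a i * b i) ≠ 0) ∧
    ∀ i j k, c k (a i * b j) ≠ 0 → u i + v j + w k < 0 ∨ (i = j ∧ j = k)

/-! ### Leading positions in the common kernel of linear forms. -/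

section Pivots

variable {ι α K : Type*} [Fintype ι] [LinearOrder α] [Field K]

/-- The leading positions, for the order induced by `f`, of the vectors annihilated by `g`. -/
def pivots {c : ℕ} (f : ι → α) (g : Fin c → ι → K) : Set ι :=
  {i | ∃ x : ι → K, (∀ l, ∑ j, g l j * x j = 0) ∧ x i ≠ 0 ∧ ∀ j, x j ≠ 0 → f i ≤ f j}

open Classical in
-- A nonzero kernel vector is nonzero at its own leading position, a pivot. Hence the `c` forms
-- together with the pivot coordinates separate vectors.
theorem card_compl_pivots_le {c : ℕ} (f : ι → α) (g : Fin c → ι → K) :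
    (Finset.univ.filter fun i => i ∉ pivots f g).card ≤ c := by
  let L : (ι → K) →ₗ[K] (Fin c → K) × ({i // i ∈ pivots f g} → K) :=
    (Matrix.mulVecLin (Matrix.of g)).prod (LinearMap.funLeft K K Subtype.val)
  have hL : Function.Injective L := by
    rw [← LinearMap.ker_eq_bot, LinearMap.ker_eq_bot']
    intro x hx
    have h1 : ∀ l, ∑ j, g l j * x j = 0 := fun l => congrFun (congrArg Prod.fst hx) l
    have h2 : ∀ i : {i // i ∈ pivots f g}, x i = 0 := fun i => congrFun (congrArg Prod.snd hx) i
    by_contra hne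
    obtain ⟨i0, hi0⟩ := Function.ne_iff.1 hne
    obtain ⟨i, hi, hmin⟩ := Finset.exists_min_image (Finset.univ.filter fun i => x i ≠ 0) f
      ⟨i0, by simpa using hi0⟩
    simp only [Finset.mem_filter, Finset.mem_univ, true_and] at hi hmin
    exact hi (h2 ⟨i, x, h1, hi, hmin⟩)
  have h := LinearMap.finrank_le_finrank_of_injective hL
  rw [Module.finrank_prod, Module.finrank_fintype_fun_eq_card, Module.finrank_fintype_fun_eq_card,
    Module.finrank_fintype_fun_eq_card, Fintype.card_fin, Fintype.card_subtype] at h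
  have h' := Finset.card_filter_add_card_filter_not (s := (Finset.univ : Finset ι))
    (fun i => i ∈ pivots f g)
  rw [Finset.card_univ] at h'
  omega

end Pivots

/-! ### Slices under linear changes of variables. -/

section Contraction

variable {X Y Z X' Y' Z' K : Type*} [Fintype X] [Fintype Y] [Fintype Z] [Field K]

theorem sum_slice_one {a : ℕ} (f : Fin a → X → Y → K) (g : Fin a → Z → K)
    (α : X → K) (β : Y → K) (γ : Z → K) :
    ∑ x, ∑ y, ∑ z, α x * β y * γ z * ∑ l, f l x y * g l z =
      ∑ l, (∑ x, ∑ y, α x * β y * f l x y) * ∑ z, g l z * γ z := by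
  simp_rw [Finset.sum_mul, Finset.mul_sum]
  rw [Finset.sum_comm (s := (Finset.univ : Finset (Fin a)))]
  refine Finset.sum_congr rfl fun x _ => ?_
  rw [Finset.sum_comm (s := (Finset.univ : Finset (Fin a)))]
  refine Finset.sum_congr rfl fun y _ => ?_
  rw [Finset.sum_comm (s := (Finset.univ : Finset (Fin a)))]
  exact Finset.sum_congr rfl fun z _ => Finset.sum_congr rfl fun l _ => by ring

theorem sum_slice_two {a : ℕ} (f : Fin a → X → Z → K) (g : Fin a → Y → K)
    (α : X → K) (β : Y → K) (γ : Z → K) :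
    ∑ x, ∑ y, ∑ z, α x * β y * γ z * ∑ l, f l x z * g l y =
      ∑ l, (∑ x, ∑ z, α x * γ z * f l x z) * ∑ y, g l y * β y := by
  rw [← sum_slice_one]
  refine Finset.sum_congr rfl fun x _ => ?_
  rw [Finset.sum_comm]
  exact Finset.sum_congr rfl fun z _ => Finset.sum_congr rfl fun y _ => by ring

theorem sum_slice_three {a : ℕ} (f : Fin a → Y → Z → K) (g : Fin a → X → K)
    (α : X → K) (β : Y → K) (γ : Z → K) :
    ∑ x, ∑ y, ∑ z, α x * β y * γ z * ∑ l, f l y z * g l x =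
      ∑ l, (∑ y, ∑ z, β y * γ z * f l y z) * ∑ x, g l x * α x := by
  rw [← sum_slice_two, Finset.sum_comm]
  exact Finset.sum_congr rfl fun y _ => Finset.sum_congr rfl fun x _ =>
    Finset.sum_congr rfl fun z _ => by ring

/-- A linear change of variables in each of the three factors does not increase the number of
slices. -/
theorem HasSliceDecomp.contract {T : X → Y → Z → K} {r : ℕ} (h : HasSliceDecomp T r)
    (α : X' → X → K) (β : Y' → Y → K) (γ : Z' → Z → K) :
    HasSliceDecomp (fun i j k => ∑ x, ∑ y, ∑ z, α i x * β j y * γ k z * T x y z) r := by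
  obtain ⟨a, b, c, hr, f₁, g₁, f₂, g₂, f₃, g₃, hT⟩ := h
  refine ⟨a, b, c, hr,
    fun l i j => ∑ x, ∑ y, α i x * β j y * f₁ l x y, fun l k => ∑ z, g₁ l z * γ k z,
    fun l i k => ∑ x, ∑ z, α i x * γ k z * f₂ l x z, fun l j => ∑ y, g₂ l y * β j y,
    fun l j k => ∑ y, ∑ z, β j y * γ k z * f₃ l y z, fun l i => ∑ x, g₃ l x * α i x, ?_⟩
  intro i j k
  simp_rw [hT, mul_add, Finset.sum_add_distrib, sum_slice_one, sum_slice_two, sum_slice_three]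

end Contraction

/-! ### Slice rank from a weighted diagonal. -/

section LowerBound

variable {ι K : Type*} [Fintype ι] [Field K]

/-- A tensor which degenerates to a diagonal tensor of full size has full slice rank. -/
theorem HasSliceDecomp.card_le_of_weights {S : ι → ι → ι → K} {r : ℕ} (h : HasSliceDecomp S r)
    (u v w : ι → ℤ) (h0 : ∀ i, u i + v i + w i = 0) (hd : ∀ i, S i i i ≠ 0)
    (hS : ∀ i j k, S i j k ≠ 0 → u i + v j + w k < 0 ∨ (i = j ∧ j = k)) :
    Fintype.card ι ≤ r := by
  classical
  obtain ⟨a, b, c, hr, f₁, g₁, f₂, g₂, f₃, g₃, hT⟩ := h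
  let e := Fintype.equivFin ι
  -- Ties in weight are broken in opposite directions for `x` and `y`, so that a diagonal term can
  -- only survive at `t` itself.
  let kx : ι → ℤ ×ₗ ℤ := fun i => toLex (u i, (e i : ℤ))
  let ky : ι → ℤ ×ₗ ℤ := fun i => toLex (v i, -(e i : ℤ))
  let kz : ι → ℤ ×ₗ ℤ := fun i => toLex (w i, 0)
  have hcx := card_compl_pivots_le kx g₃
  have hcy := card_compl_pivots_le ky g₂
  have hcz := card_compl_pivots_le kz g₁
  by_contra hlt
  -- The three sets of non-pivots have at most `r` elements in total, too few to cover `ι`. At a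
  -- common pivot `t` the three kernel vectors kill every slice, while their contraction with `S`
  -- reduces to the nonzero term at `t`.
  have : ∃ t, t ∈ pivots kx g₃ ∧ t ∈ pivots ky g₂ ∧ t ∈ pivots kz g₁ := by
    by_contra hno
    have hsub : (Finset.univ : Finset ι) ⊆ (Finset.univ.filter fun i => i ∉ pivots kx g₃) ∪
        ((Finset.univ.filter fun i => i ∉ pivots ky g₂) ∪
        (Finset.univ.filter fun i => i ∉ pivots kz g₁)) := by
      intro t _
      simp only [Finset.mem_union, Finset.mem_filter, Finset.mem_univ, true_and]
      by_contra hh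
      push Not at hh
      exact hno ⟨t, hh⟩
    have := (Finset.card_le_card hsub).trans ((Finset.card_union_le _ _).trans
      (Nat.add_le_add_left (Finset.card_union_le _ _) _))
    rw [Finset.card_univ] at this
    omega
  obtain ⟨t, ⟨x, hx0, hxt, hx⟩, ⟨y, hy0, hyt, hy⟩, ⟨z, hz0, hzt, hz⟩⟩ := this
  have hle : ∀ i j k, x i * y j * z k * S i j k ≠ 0 → i = t ∧ j = t ∧ k = t := by
    intro i j k hne
    simp only [ne_eq, mul_eq_zero, not_or] at hne
    have h1 := hx i hne.1.1.1
    have h2 := hy j hne.1.1.2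
    have h3 := hz k hne.1.2
    have h4 := h0 t
    have h5 := h0 i
    simp only [kx, ky, kz, Prod.Lex.toLex_le_toLex] at h1 h2 h3
    rcases hS i j k hne.2 with h | ⟨rfl, rfl⟩
    · omega
    · have : e i = e t := by
        apply Fin.ext
        omega
      have := e.injective this
      exact ⟨this, this, this⟩
  have hsum : ∑ i, ∑ j, ∑ k, x i * y j * z k * S i j k = x t * y t * z t * S t t t := by
    rw [Finset.sum_eq_single t, Finset.sum_eq_single t, Finset.sum_eq_single t]
    · exact fun k _ hk => by_contra fun hn => hk (hle t t k hn).2.2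
    · simp
    · exact fun j _ hj => Finset.sum_eq_zero fun k _ => by_contra fun hn => hj (hle t j k hn).2.1
    · simp
    · exact fun i _ hi => Finset.sum_eq_zero fun j _ => Finset.sum_eq_zero fun k _ =>
        by_contra fun hn => hi (hle i j k hn).1
    · simp
  have hzero : ∑ i, ∑ j, ∑ k, x i * y j * z k * S i j k = 0 := by
    simp_rw [hT, mul_add, Finset.sum_add_distrib, sum_slice_one, sum_slice_two, sum_slice_three,
      hx0, hy0, hz0]
    simp
  rw [hsum] at hzero
  exact (mul_ne_zero (mul_ne_zero (mul_ne_zero hxt hyt) hzt) (hd t)) hzero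

end LowerBound

/-! ### Degenerations of products and of matrix algebras. -/

section Algebras

variable {K : Type*} [Field K]

/-- A diagonal degeneration bounds the number of slices of the multiplication tensor from below. -/
theorem HasDiagonalDegeneration.le_of_hasSliceDecomp {A ι : Type*} [Ring A] [Algebra K A]
    [Fintype ι] {N r : ℕ} (h : HasDiagonalDegeneration K A N) (x : Module.Basis ι K A)
    (hr : HasSliceDecomp (multTensor x) r) : N ≤ r := by
  obtain ⟨κ, _, a, b, c, u, v, w, rfl, h0, hd, hS⟩ := h
  have key : (fun i j k => ∑ p, ∑ q, ∑ s, x.repr (a i) p * x.repr (b j) q * c k (x s) *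
      multTensor x p q s) = fun i j k => c k (a i * b j) := by
    funext i j k
    conv_rhs => rw [← x.sum_repr (a i), ← x.sum_repr (b j)]
    simp_rw [Finset.sum_mul_sum, map_sum, smul_mul_smul_comm, map_smul]
    refine Finset.sum_congr rfl fun p _ => Finset.sum_congr rfl fun q _ => ?_
    conv_rhs => rw [← x.sum_repr (x p * x q)]
    simp_rw [map_sum, map_smul, smul_eq_mul, Finset.mul_sum, multTensor]
    exact Finset.sum_congr rfl fun s _ => by ring
  have h := hr.contract (fun i => x.repr (a i)) (fun j => x.repr (b j)) (fun k s => c k (x s))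
  rw [key] at h
  exact h.card_le_of_weights u v w h0 hd hS

theorem HasDiagonalDegeneration.of_algEquiv {A B : Type*} [Ring A] [Algebra K A] [Ring B]
    [Algebra K B] {N : ℕ} (h : HasDiagonalDegeneration K B N) (e : A ≃ₐ[K] B) :
    HasDiagonalDegeneration K A N := by
  obtain ⟨κ, i, a, b, c, u, v, w, hN, h0, hd, hS⟩ := h
  refine ⟨κ, i, fun i => e.symm (a i), fun i => e.symm (b i), fun i => c i ∘ₗ e.toLinearMap,
    u, v, w, hN, h0, ?_, ?_⟩
  · simpa using hd
  · simpa using hS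

theorem HasDiagonalDegeneration.pi {n : ℕ} {A : Fin n → Type*} [∀ t, Ring (A t)]
    [∀ t, Algebra K (A t)] {N : Fin n → ℕ} (h : ∀ t, HasDiagonalDegeneration K (A t) (N t)) :
    HasDiagonalDegeneration K (∀ t, A t) (∑ t, N t) := by
  choose κ i a b c u v w hN h0 hd hS using h
  refine ⟨Σ t, κ t, inferInstance, fun q => Pi.single q.1 (a q.1 q.2),
    fun q => Pi.single q.1 (b q.1 q.2), fun q => c q.1 q.2 ∘ₗ LinearMap.proj q.1,
    fun q => u q.1 q.2, fun q => v q.1 q.2, fun q => w q.1 q.2, by simp [hN],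
    fun q => h0 _ _, ?_, ?_⟩
  · rintro ⟨t, q⟩
    simpa using hd t q
  · rintro ⟨t, q⟩ ⟨t', q'⟩ ⟨t'', q''⟩ hne
    simp only [LinearMap.comp_apply, LinearMap.proj_apply, Pi.mul_apply] at hne
    obtain rfl : t'' = t := by
      by_contra hn
      simp [Pi.single_eq_of_ne hn] at hne
    obtain rfl : t'' = t' := by
      by_contra hn
      simp [Pi.single_eq_of_ne hn] at hne
    simp only [Pi.single_eq_same] at hne
    rcases hS _ _ _ _ hne with h | ⟨rfl, rfl⟩
    · exact Or.inl h
    · exact Or.inr ⟨rfl, rfl⟩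

/-- The prescribed sum is, for positive `d`, the midpoint `3(d - 1)/2` rounded up. With `d = 2h +
e`, the map `f` lists `h(h + e)` triples whose first entry is at least `h + e` and whose last is
below it. Their three cyclic rotations are disjoint, and for `e = 1` the triple `(h, h, h)` is
extra. -/
theorem three_mul_sq_le_card_triples (d : ℕ) :
    3 * d ^ 2 ≤ 4 * Fintype.card {q : Fin d × Fin d × Fin d //
      (q.1 : ℕ) + q.2.1 + q.2.2 = 3 * (d / 2) + d % 2 - 1} := by
  obtain ⟨h, e, he, rfl⟩ : ∃ h e, e < 2 ∧ d = 2 * h + e :=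
    ⟨d / 2, d % 2, Nat.mod_lt _ two_pos, (Nat.div_add_mod d 2).symm⟩
  rw [show 3 * ((2 * h + e) / 2) + (2 * h + e) % 2 - 1 = 3 * h + e - 1 by omega]
  let f (a : Fin h) (b : Fin (h + e)) : ℕ × ℕ × ℕ :=
    (h + e + a, 3 * h + e - 1 - (h + e + a) - (h + e - 1 - b), h + e - 1 - b)
  have hf : ∀ a b, (f a b).1 + (f a b).2.1 + (f a b).2.2 = 3 * h + e - 1 ∧ h + e ≤ (f a b).1 ∧
      (f a b).1 < 2 * h + e ∧ (f a b).2.1 < 2 * h + e ∧ (f a b).2.2 < h + e := by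
    intro a b
    simp only [f]
    omega
  have hinj : ∀ a b a' b', (f a b).1 = (f a' b').1 → (f a b).2.2 = (f a' b').2.2 →
      a = a' ∧ b = b' := by
    intro a b a' b'
    simp only [f, Fin.ext_iff]
    omega
  clear_value f
  let F : (Fin h × Fin (h + e)) ⊕ (Fin h × Fin (h + e)) ⊕ (Fin h × Fin (h + e)) ⊕ Fin e →
      {q : Fin (2 * h + e) × Fin (2 * h + e) × Fin (2 * h + e) //
        (q.1 : ℕ) + q.2.1 + q.2.2 = 3 * h + e - 1} := fun
    | .inl p => ⟨(⟨(f p.1 p.2).1, by have := hf p.1 p.2; omega⟩,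
        ⟨(f p.1 p.2).2.1, by have := hf p.1 p.2; omega⟩,
        ⟨(f p.1 p.2).2.2, by have := hf p.1 p.2; omega⟩), by have := hf p.1 p.2; dsimp only; omega⟩
    | .inr (.inl p) => ⟨(⟨(f p.1 p.2).2.2, by have := hf p.1 p.2; omega⟩,
        ⟨(f p.1 p.2).1, by have := hf p.1 p.2; omega⟩,
        ⟨(f p.1 p.2).2.1, by have := hf p.1 p.2; omega⟩), by have := hf p.1 p.2; dsimp only; omega⟩
    | .inr (.inr (.inl p)) => ⟨(⟨(f p.1 p.2).2.1, by have := hf p.1 p.2; omega⟩,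
        ⟨(f p.1 p.2).2.2, by have := hf p.1 p.2; omega⟩,
        ⟨(f p.1 p.2).1, by have := hf p.1 p.2; omega⟩), by have := hf p.1 p.2; dsimp only; omega⟩
    | .inr (.inr (.inr i)) => ⟨(⟨h, by have := i.2; omega⟩, ⟨h, by have := i.2; omega⟩,
        ⟨h, by have := i.2; omega⟩), by have := i.2; dsimp only; omega⟩
  have hF : Function.Injective F := by
    rintro (p | p | p | p) (q | q | q | q) heq
    all_goals
      simp only [F, Subtype.mk.injEq, Prod.mk.injEq, Fin.ext_iff] at heq
      obtain ⟨h1, h2, h3⟩ := heq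
      first
      | have hp := hf p.1 p.2
        have hq := hf q.1 q.2
        have := hinj p.1 p.2 q.1 q.2
        first
        | exfalso
          omega
        | obtain ⟨h4, h5⟩ := this (by omega) (by omega)
          rw [Prod.ext h4 h5]
      | have hp := hf p.1 p.2
        have hq := q.2
        omega
      | have hq := hf q.1 q.2
        have hp := p.2
        omega
      | congr 3
        apply Fin.ext
        omega
  have hcard := Fintype.card_le_of_injective F hF
  simp only [Fintype.card_sum, Fintype.card_prod, Fintype.card_fin] at hcard
  interval_cases e <;> nlinarith

/-- Strassen's degeneration of matrix multiplication. -/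
theorem hasDiagonalDegeneration_matrix (d : ℕ) :
    ∃ N, 3 * d ^ 2 ≤ 4 * N ∧ HasDiagonalDegeneration K (Matrix (Fin d) (Fin d) K) N := by
  refine ⟨_, three_mul_sq_le_card_triples d, ?_⟩
  generalize 3 * (d / 2) + d % 2 - 1 = s
  refine ⟨_, inferInstance, fun q => Matrix.single q.1.1 q.1.2.1 1,
    fun q => Matrix.single q.1.2.1 q.1.2.2 1,
    fun q => Matrix.entryLinearMap K K q.1.1 q.1.2.2,
    -- On the support of the product the three weights add up to `-(i + j + k - s) ^ 2`.
    fun q => -((q.1.1 : ℤ) ^ 2 + 2 * q.1.1 * q.1.2.1 - 2 * s * q.1.1),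
    fun q => -((q.1.2.1 : ℤ) ^ 2 + 2 * q.1.2.1 * q.1.2.2 - 2 * s * q.1.2.1),
    fun q => -((q.1.2.2 : ℤ) ^ 2 + 2 * q.1.2.2 * q.1.1 - 2 * s * q.1.2.2 + s ^ 2), rfl, ?_, ?_, ?_⟩
  · rintro ⟨⟨i, j, k⟩, h⟩
    dsimp only at h ⊢
    subst h
    push_cast
    ring
  · rintro ⟨⟨i, j, k⟩, h⟩
    simp
  · rintro ⟨⟨i, j, k⟩, h⟩ ⟨⟨i', j', k'⟩, h'⟩ ⟨⟨i'', j'', k''⟩, h''⟩ hne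
    dsimp only at h h' h'' hne ⊢
    obtain rfl : j = j' := by
      by_contra hn
      simp [Matrix.single_mul_single_of_ne _ _ _ _ hn] at hne
    rw [Matrix.single_mul_single_same, Matrix.entryLinearMap_apply, Matrix.single_apply] at hne
    obtain ⟨rfl, rfl⟩ : i = i'' ∧ k' = k'' := by
      by_contra hn
      simp [hn] at hne
    by_cases hs : (i : ℕ) + j + k' = s
    · right
      simp only [Subtype.mk.injEq, Prod.mk.injEq, Fin.ext_iff, true_and, and_true]
      omega
    · left
      have : 0 < ((i : ℤ) + j + k' - s) ^ 2 := by
        apply sq_pos_of_ne_zero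
        omega
      linarith

end Algebras

/-! ### Lifting along a central nilpotent element. -/

section Central

variable {K : Type*} [Field K]

/-- Passing from a quotient by a central nilpotent element to the algebra itself. -/
theorem HasDiagonalDegeneration.of_central_nilpotent {A B : Type*} [Ring A] [Algebra K A] [Ring B]
    [Algebra K B] {N p : ℕ} (h : HasDiagonalDegeneration K B N) (hp : 0 < p) (x : A)
    (hx : ∀ a, Commute x a) (hxp : x ^ p = 0) (π : A →ₐ[K] B) (hπ : Function.Surjective π)
    (θ : A →ₗ[K] B) (hθ : ∀ a, θ (a * x ^ (p - 1)) = π a) :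
    HasDiagonalDegeneration K A (N * ((p + 1) / 2)) := by
  obtain ⟨κ, _, a, b, c, u, v, w, rfl, h0, hd, hS⟩ := h
  choose a' ha' using fun i => hπ (a i)
  choose b' hb' using fun i => hπ (b i)
  obtain ⟨Mu, hMu⟩ := (Set.finite_range u).bddAbove
  obtain ⟨Mv, hMv⟩ := (Set.finite_range v).bddAbove
  obtain ⟨Mw, hMw⟩ := (Set.finite_range w).bddAbove
  simp only [mem_upperBounds, Set.forall_mem_range] at hMu hMv hMw
  -- `C` is large enough that one unit of `2 * d - l - m` outweighs the old weights and the term `2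
  -- * d ^ 2`.
  obtain ⟨C, hC0, hC⟩ : ∃ C : ℤ, 0 ≤ C ∧ 2 * (p : ℤ) ^ 2 + Mu + Mv + Mw < C :=
    ⟨max 0 (2 * (p : ℤ) ^ 2 + Mu + Mv + Mw + 1), le_max_left _ _,
      (lt_add_one _).trans_le (le_max_right _ _)⟩
  have hval : ∀ i j (l m d : Fin ((p + 1) / 2)),
      θ (a' i * x ^ (l : ℕ) * (b' j * x ^ (m : ℕ)) * x ^ (p - 1 - 2 * (d : ℕ))) =
        θ (a' i * b' j * x ^ ((l : ℕ) + m + (p - 1 - 2 * d))) := by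
    intro i j l m d
    congr 1
    rw [pow_add, pow_add, mul_assoc (a' i), ← mul_assoc (x ^ (l : ℕ)),
      ((hx (b' j)).pow_left l).eq]
    simp only [mul_assoc]
  have hval0 : ∀ i j k (l m d : Fin ((p + 1) / 2)), (l : ℕ) + m = 2 * d →
      c k (θ (a' i * b' j * x ^ ((l : ℕ) + m + (p - 1 - 2 * d)))) = c k (a i * b j) := by
    intro i j k l m d hlm
    rw [show (l : ℕ) + m + (p - 1 - 2 * d) = p - 1 by omega, hθ, map_mul, ha', hb']
  refine ⟨κ × Fin ((p + 1) / 2), inferInstance, fun q => a' q.1 * x ^ (q.2 : ℕ),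
    fun q => b' q.1 * x ^ (q.2 : ℕ),
    -- The subtraction does not truncate, as `2 * d ≤ p - 1`. A nonzero value forces `l + m ≤ 2 *
    -- d`; the linear weights handle strict inequality, and at equality the quadratic ones add `-2 *
    -- (l - d) ^ 2`, isolating `l = m = d`.
    fun q => c q.1 ∘ₗ θ ∘ₗ LinearMap.mulRight K (x ^ (p - 1 - 2 * (q.2 : ℕ))),
    fun q => u q.1 + C * (q.2 : ℕ) - (q.2 : ℕ) ^ 2,
    fun q => v q.1 + C * (q.2 : ℕ) - (q.2 : ℕ) ^ 2,
    fun q => w q.1 - 2 * C * (q.2 : ℕ) + 2 * (q.2 : ℕ) ^ 2, by simp, ?_, ?_, ?_⟩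
  · rintro ⟨i, l⟩
    dsimp only
    linarith [h0 i]
  · rintro ⟨i, l⟩
    simp only [LinearMap.comp_apply, LinearMap.mulRight_apply]
    rw [hval i i, hval0 i i i _ _ _ (by omega)]
    exact hd i
  · rintro ⟨i, l⟩ ⟨j, m⟩ ⟨k, d⟩ hne
    simp only [LinearMap.comp_apply, LinearMap.mulRight_apply] at hne
    rw [hval i j] at hne
    have hu := hMu i
    have hv := hMv j
    have hw := hMw k
    have hle : (l : ℕ) + m ≤ 2 * d := by
      by_contra hlt
      rw [pow_eq_zero_of_le (by omega) hxp] at hne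
      simp at hne
    rcases hle.lt_or_eq with hlt | heq
    · left
      dsimp only
      have hd2 : (d : ℤ) ^ 2 ≤ (p : ℤ) ^ 2 := by
        have : (d : ℤ) ≤ p := by omega
        gcongr
      have : C * ((l : ℤ) + m - 2 * d) ≤ C * (-1) := by
        apply mul_le_mul_of_nonneg_left _ hC0
        omega
      nlinarith [sq_nonneg (l : ℤ), sq_nonneg (m : ℤ)]
    · rw [hval0 i j k _ _ _ heq] at hne
      have hm : ((m : ℕ) : ℤ) = 2 * (d : ℕ) - (l : ℕ) := by omega
      dsimp only
      rw [hm]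
      have hs : 0 ≤ ((l : ℤ) - d) ^ 2 := sq_nonneg _
      rcases hS i j k hne with h | ⟨rfl, rfl⟩
      · left
        nlinarith
      · by_cases hld : l = d
        · right
          subst hld
          have : l = m := Fin.ext (by omega)
          subst this
          simp
        · left
          have : 0 < ((l : ℤ) - d) ^ 2 := by
            apply sq_pos_of_ne_zero
            rw [Fin.ext_iff] at hld
            omega
          nlinarith [h0 i]

/-- Proved for polynomials over `ZMod p`, where `X - 1` can be cancelled from `(X - 1) ^ p = X ^ p -
1`, then evaluated at `z`. -/
theorem sub_one_pow_pred_eq_sum {R : Type*} [Ring R] {p : ℕ} [Fact p.Prime] [CharP R p]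
    (z : R) : (z - 1) ^ (p - 1) = ∑ i ∈ Finset.range p, z ^ i := by
  have hpoly : (Polynomial.X - 1 : Polynomial (ZMod p)) ^ (p - 1) =
      ∑ i ∈ Finset.range p, Polynomial.X ^ i := by
    have hne : (Polynomial.X - 1 : Polynomial (ZMod p)) ≠ 0 := by
      simpa using Polynomial.X_sub_C_ne_zero (1 : ZMod p)
    apply mul_right_cancel₀ hne
    rw [geom_sum_mul, ← pow_succ, Nat.sub_add_cancel (Fact.out : p.Prime).one_le, sub_pow_char,
      one_pow]
  let := ZMod.algebra R p
  simpa using congrArg (Polynomial.aeval z) hpoly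

end Central

/-- A finite nilpotent group is the product of its Sylow subgroups, and a nontrivial `p`-group has
nontrivial center. A central element of order `p` in the Sylow `p`-factor stays central in the
product. -/
theorem exists_mem_center_orderOf_eq {G : Type*} [Group G] [Finite G] [Group.IsNilpotent G]
    {p : ℕ} [hp : Fact p.Prime] (hdvd : p ∣ Nat.card G) :
    ∃ z ∈ Subgroup.center G, orderOf z = p := by
  classical
  obtain ⟨e⟩ := (Group.isNilpotent_of_finite_tfae.out 0 4 rfl rfl : Group.IsNilpotent G ↔ _).1 ‹_›
  let q : (Nat.card G).primeFactors :=
    ⟨p, Nat.mem_primeFactors.2 ⟨hp.out, hdvd, Nat.card_pos.ne'⟩⟩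
  let P : Sylow q G := (default : Sylow p G)
  have hP : IsPGroup p P := (default : Sylow p G).isPGroup'
  have : Nontrivial P := by
    rw [← Finite.one_lt_card_iff_nontrivial]
    have h1 := (default : Sylow p G).dvd_card_of_dvd_card hdvd
    exact hp.out.one_lt.trans_le (Nat.le_of_dvd Nat.card_pos h1)
  have := hP.center_nontrivial
  obtain ⟨n, hn0, hn⟩ := (hP.to_subgroup (Subgroup.center P)).nontrivial_iff_card.1 this
  obtain ⟨z, hz⟩ := exists_prime_orderOf_dvd_card' (G := Subgroup.center P) p
    (hn ▸ dvd_pow_self p hn0.ne')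
  refine ⟨e (Pi.mulSingle q (Pi.mulSingle P (z : P))), ?_, ?_⟩
  · rw [Subgroup.mem_center_iff]
    intro g
    obtain ⟨f, rfl⟩ := e.surjective g
    rw [← map_mul, ← map_mul]
    congr 1
    funext q' P'
    by_cases hq : q' = q
    · subst hq
      by_cases hPP : P' = P
      · subst hPP
        simpa using (Subgroup.mem_center_iff.1 z.2 (f q P))
      · simp [Pi.mulSingle_eq_of_ne hPP]
    · simp [Pi.mulSingle_eq_of_ne hq]
  · rw [MulEquiv.orderOf_eq, orderOf_piMulSingle, orderOf_piMulSingle, Subgroup.orderOf_coe, hz]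

/-! ### Group algebras and central quotients. -/

section Group

variable {K G : Type*} [Field K] [Group G]

/-- The map to the group algebra of a quotient which keeps only the coefficients at a chosen
system of representatives. -/
noncomputable def transversalProjection (K : Type*) [Field K] (H : Subgroup G) [H.Normal] :
    MonoidAlgebra K G →ₗ[K] MonoidAlgebra K (G ⧸ H) :=
  open Classical in
  (MonoidAlgebra.basis G K).constr K fun g =>
    if g = (g : G ⧸ H).out then MonoidAlgebra.single (g : G ⧸ H) 1 else 0

open Classical in
theorem transversalProjection_single (H : Subgroup G) [H.Normal] (g : G) :
    transversalProjection K H (MonoidAlgebra.single g 1) =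
      if g = (g : G ⧸ H).out then MonoidAlgebra.single (g : G ⧸ H) 1 else 0 := by
  rw [show (MonoidAlgebra.single g 1 : MonoidAlgebra K G) = MonoidAlgebra.basis G K g by
    simp [MonoidAlgebra.basis]]
  exact Module.Basis.constr_basis _ _ _ _

theorem HasDiagonalDegeneration.of_quotient_zpowers [Finite G] {p N : ℕ} [hp : Fact p.Prime] [CharP K p]
    {z : G} (hz : z ∈ Subgroup.center G) (hzp : orderOf z = p)
    [hN : (Subgroup.zpowers z).Normal]
    (h : HasDiagonalDegeneration K (MonoidAlgebra K (G ⧸ Subgroup.zpowers z)) N) :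
    HasDiagonalDegeneration K (MonoidAlgebra K G) (N * ((p + 1) / 2)) := by
  classical
  have hcz : ∀ a : MonoidAlgebra K G, Commute (MonoidAlgebra.single z (1 : K)) a := by
    intro a
    refine MonoidAlgebra.single_commute (fun g => ?_) (fun r => Commute.one_left r) a
    exact (Subgroup.mem_center_iff.1 hz g).symm
  have : CharP (MonoidAlgebra K G) p := charP_of_injective_algebraMap
    (algebraMap K (MonoidAlgebra K G)).injective p
  have hpow : ∀ i, (MonoidAlgebra.single z (1 : K)) ^ i = MonoidAlgebra.single (z ^ i) 1 := by
    intro i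
    rw [MonoidAlgebra.single_pow, one_pow]
  refine h.of_central_nilpotent hp.out.pos (MonoidAlgebra.single z 1 - 1)
    (fun a => (hcz a).sub_left (Commute.one_left a)) ?_
    (MonoidAlgebra.mapDomainAlgHom K K (QuotientGroup.mk' (Subgroup.zpowers z)))
    ?_ (transversalProjection K (Subgroup.zpowers z)) ?_
  · rw [sub_pow_char_of_commute _ (Commute.one_right _), hpow, ← hzp, pow_orderOf_eq_one, one_pow,
      MonoidAlgebra.one_def, sub_self]
  · intro b
    induction b using MonoidAlgebra.induction_linear with
    | zero => exact ⟨0, map_zero _⟩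
    | add f g hf hg =>
      obtain ⟨f', rfl⟩ := hf
      obtain ⟨g', rfl⟩ := hg
      exact ⟨f' + g', map_add _ _ _⟩
    | single q r =>
      obtain ⟨g, rfl⟩ := QuotientGroup.mk_surjective q
      exact ⟨MonoidAlgebra.single g r, by simp⟩
  · intro a
    rw [sub_one_pow_pred_eq_sum]
    simp_rw [hpow]
    induction a using MonoidAlgebra.induction_linear with
    | zero => simp
    | add f g hf hg => rw [add_mul, map_add, map_add, hf, hg]
    | single g r =>
      rw [show MonoidAlgebra.single g r = r • MonoidAlgebra.single g 1 by simp,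
        smul_mul_assoc, map_smul, map_smul]
      congr 1
      rw [Finset.mul_sum, map_sum]
      simp_rw [MonoidAlgebra.single_mul_single, mul_one, transversalProjection_single]
      have hmk : ∀ i : ℕ, ((g * z ^ i : G) : G ⧸ Subgroup.zpowers z) = g := fun i =>
        QuotientGroup.mk_mul_of_mem g (Subgroup.npow_mem_zpowers z i)
      simp_rw [hmk]
      -- Exactly one of the elements `g * z ^ i` with `i < p` is the chosen representative of its
      -- coset, so the sum collapses to one term.
      obtain ⟨⟨y, hy⟩, hyg⟩ := QuotientGroup.mk_out_eq_mul (Subgroup.zpowers z) g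
      rw [mem_zpowers_iff_mem_range_orderOf, hzp, Finset.mem_image] at hy
      obtain ⟨i, hi, rfl⟩ := hy
      rw [hyg, Finset.sum_eq_single i]
      · simp
      · intro j hj hji
        rw [if_neg]
        intro hgz
        rw [Finset.mem_range, ← hzp] at hi hj
        exact hji (pow_injOn_Iio_orderOf hj hi (mul_left_cancel hgz))
      · exact fun h => absurd hi h

theorem hasDiagonalDegeneration_of_card_ne_zero [Finite G] [IsAlgClosed K]
    [NeZero (Nat.card G : K)] :
    ∃ N, 3 * Nat.card G ≤ 4 * N ∧ HasDiagonalDegeneration K (MonoidAlgebra K G) N := by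
  have : FiniteDimensional K (MonoidAlgebra K G) :=
    (MonoidAlgebra.basis G K).finiteDimensional_of_finite
  obtain ⟨n, d, -, ⟨e⟩⟩ :=
    IsSemisimpleRing.exists_algEquiv_pi_matrix_of_isAlgClosed K (MonoidAlgebra K G)
  choose N hN hD using fun t => hasDiagonalDegeneration_matrix (K := K) (d t)
  refine ⟨_, ?_, (HasDiagonalDegeneration.pi hD).of_algEquiv e⟩
  have h := e.toLinearEquiv.finrank_eq
  rw [Module.finrank_eq_nat_card_basis (MonoidAlgebra.basis G K), Module.finrank_pi_fintype] at h
  simp only [Module.finrank_matrix, Fintype.card_fin, Module.finrank_self, mul_one] at h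
  rw [h, Finset.mul_sum, Finset.mul_sum]
  exact Finset.sum_le_sum fun t _ => by rw [← sq]; exact hN t

end Group

theorem exists_hasDiagonalDegeneration {K : Type*} [Field K] [IsAlgClosed K] {p r : ℕ}
    [hp : Fact p.Prime] [CharP K p] (hpr : p.Coprime r) (n : ℕ) :
    ∀ (G : Type*) [Group G] [Finite G] [Group.IsNilpotent G], Nat.card G = p ^ n * r →
      ∃ N, 3 * (p ^ n * r) ≤ 2 ^ (n + 2) * N ∧
        HasDiagonalDegeneration K (MonoidAlgebra K G) N := by
  induction n with
  | zero =>
    intro G _ _ _ hG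
    have : NeZero (Nat.card G : K) := ⟨by
      rw [hG, pow_zero, one_mul, Ne, CharP.cast_eq_zero_iff K p]
      exact (Nat.Prime.coprime_iff_not_dvd hp.out).1 hpr⟩
    obtain ⟨N, hN, hD⟩ := hasDiagonalDegeneration_of_card_ne_zero (K := K) (G := G)
    exact ⟨N, by rw [← hG]; exact hN, hD⟩
  | succ n ih =>
    intro G _ _ _ hG
    obtain ⟨z, hz, hzp⟩ := exists_mem_center_orderOf_eq (G := G) (p := p)
      (by rw [hG, pow_succ, mul_assoc]; exact (dvd_mul_right p r).mul_left _)
    have hle : Subgroup.zpowers z ≤ Subgroup.center G := by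
      rwa [Subgroup.zpowers_le]
    have : (Subgroup.zpowers z).Normal := ⟨fun y hy g => by
      rwa [Subgroup.mem_center_iff.1 (hle hy) g, mul_inv_cancel_right]⟩
    obtain ⟨N, hN, hD⟩ := ih (G ⧸ Subgroup.zpowers z) (by
      have h := Subgroup.card_eq_card_quotient_mul_card_subgroup (Subgroup.zpowers z)
      rw [hG, Nat.card_zpowers, hzp] at h
      apply Nat.eq_of_mul_eq_mul_right hp.out.pos
      rw [← h]
      ring)
    refine ⟨_, ?_, hD.of_quotient_zpowers hz hzp⟩
    -- Each factor `p` of the order costs at most a factor 2.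
    have hp2 : p ≤ 2 * ((p + 1) / 2) := by omega
    calc 3 * (p ^ (n + 1) * r) = 3 * (p ^ n * r) * p := by ring
      _ ≤ 2 ^ (n + 2) * N * (2 * ((p + 1) / 2)) := Nat.mul_le_mul hN hp2
      _ = 2 ^ (n + 1 + 2) * (N * ((p + 1) / 2)) := by ring

theorem HasSliceDecomp.map {X Y Z K L : Type*} [Field K] [Field L] {T : X → Y → Z → K} {r : ℕ}
    (h : HasSliceDecomp T r) (φ : K →+* L) : HasSliceDecomp (fun x y z => φ (T x y z)) r := by
  obtain ⟨a, b, c, hr, f₁, g₁, f₂, g₂, f₃, g₃, hT⟩ := h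
  exact ⟨a, b, c, hr, fun l x y => φ (f₁ l x y), fun l z => φ (g₁ l z),
    fun l x z => φ (f₂ l x z), fun l y => φ (g₂ l y),
    fun l y z => φ (f₃ l y z), fun l x => φ (g₃ l x), fun x y z => by simp [hT]⟩

theorem theoremA7 {G : Type*} [Group G] [Finite G] [Group.IsNilpotent G]
    (p n r : ℕ) (hp : p.Prime) (hpr : p.Coprime r) (hG : Nat.card G = p ^ n * r)
    (𝕜 : Type*) [Field 𝕜] [CharP 𝕜 p] :
    (3 * (p : ℝ) ^ n * (r : ℝ)) / 2 ^ (n + 2) ≤ (sliceRank (groupMultTensor 𝕜 G) : ℝ) := by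
  have := Fact.mk hp
  have := Fintype.ofFinite G
  have : CharP (AlgebraicClosure 𝕜) p :=
    charP_of_injective_algebraMap (algebraMap 𝕜 (AlgebraicClosure 𝕜)).injective p
  obtain ⟨N, hN, hD⟩ := exists_hasDiagonalDegeneration (K := AlgebraicClosure 𝕜) hpr n G hG
  have h := (hasSliceDecomp_sliceRank (groupMultTensor 𝕜 G)).map
    (algebraMap 𝕜 (AlgebraicClosure 𝕜))
  have heq : (fun x y z => algebraMap 𝕜 (AlgebraicClosure 𝕜) (groupMultTensor 𝕜 G x y z)) =
      groupMultTensor (AlgebraicClosure 𝕜) G := by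
    classical
    funext x y z
    rw [groupMultTensor_apply, groupMultTensor_apply, apply_ite (algebraMap _ _), map_one, map_zero]
  rw [heq] at h
  have hle := hN.trans (Nat.mul_le_mul_left _ (hD.le_of_hasSliceDecomp _ h))
  rw [div_le_iff₀ (by positivity)]
  have : (3 * ((p : ℝ) ^ n * r)) ≤ 2 ^ (n + 2) * (sliceRank (groupMultTensor 𝕜 G) : ℝ) := by
    exact_mod_cast hle
  linarith
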